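/- **Definitions.** Let $\mathfrak S_n$ be the set of permutations $\pi=\pi_1\cdots\pi_n$ of $\{1,\dots,n\}$ and $\mathfrak S=\bigsqcup_{n\ge 0}\mathfrak S_n$. The standardization $\operatorname{std}(w)$ of a word $w$ with distinct letters replaces its smallest letter by $1$, its second smallest by $2$, and so on. Let $\Gamma\subseteq\mathfrak S$. A *marked occurrence* of $\Gamma$ in $\pi\in\mathfrak S_n$ is a pair $(i,\sigma)$ with $\sigma\in\Gamma\cap\mathfrak S_m$, $i+m-1\le n$ and $\operatorname{std}(\pi_i\pi_{i+1}\cdots\pi_{i+m-1})=\sigma$; $\operatorname{occ}_\Gamma(\pi)$ is the number of marked occurrences of $\Gamma$ in $\pi$. A *marked permutation* is a pair $(\pi,T)$ with $T$ a set of marked occurrences of $\Gamma$ in $\pi$. It is a *concatenation* of the marked permutations $(\alpha,S)$ and $(\beta,U)$, where $\alpha\in\mathfrak S_a$ and $\beta\in\mathfrak S_b$, if $n=a+b$, $\operatorname{std}(\pi_1\cdots\pi_a)=\alpha$, $\operatorname{std}(\pi_{a+1}\cdots\pi_n)=\beta$ and $T=S\cup\{(a+i,\sigma):(i,\sigma)\in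 U\}$. A *$\Gamma$-cluster* on $\pi$ is a marked permutation $(\pi,T)$ that is not a concatenation of two marked permutations of positive length; $C_{\Gamma,\pi}$ is the set of $\Gamma$-clusters on $\pi$, and $\operatorname{mk}_\Gamma(c)=|T|$ for $c=(\pi,T)$. Let $\operatorname{ipk}(\pi)$ be the number of peaks of $\pi^{-1}$, i.e. of $i\in\{2,\dots,n-1\}$ with $\pi^{-1}(i-1)<\pi^{-1}(i)>\pi^{-1}(i+1)$. For $n,k\ge1$ put $$P^{\operatorname{ipk}}_{\Gamma,n}(s,t)=\sum_{\pi\in\mathfrak S_n}s^{\operatorname{occ}_\Gamma(\pi)}t^{\operatorname{ipk}(\pi)+1},\qquad R^{\operatorname{ipk}}_{\Gamma,k}(s,t)=\sum_{\pi\in\mathfrak S_k}t^{\operatorname{ipk}(\pi)+1}\sum_{c\in C_{\Gamma,\pi}}s^{\operatorname{mk}_\Gamma(c)}.$$ The Hadamard product in $t$ of $f=\sum_n a_nt^n$ and $g=\sum_n b_nt^n$, with $a_n,b_n\in\mathbb Q[s][[x]]$, is $f*g=\sum_n a_nb_nt^n$. Write $f^{*\langle n\rangle}$ for the $n$-fold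 Hadamard product of $f$, with $f^{*\langle 0\rangle}=1/(1-t)$, the identity for $*$. All other products are ordinary ones. **Theorem.** Let $\Gamma\subseteq\mathfrak S$ be a set of permutations, each of length at least $2$. Put $u=4t/(1+t)^2$ and $z=(1+t)x/(1-t)$. Then all the infinite sums below converge as formal power series in $t,x$ over $\mathbb Q[s]$ (coefficientwise), and $$\frac1{1-t}+\frac{1+t}{2(1-t)}\sum_{n=1}^\infty P^{\operatorname{ipk}}_{\Gamma,n}(s,u)\,z^n=\sum_{n=0}^\infty\left(\frac{2tx}{(1-t)^2}+\frac{1+t}{2(1-t)}\sum_{k=2}^\infty R^{\operatorname{ipk}}_{\Gamma,k}(s-1,u)\,z^k\right)^{*\langle n\rangle}.$$ -/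

import Mathlib

open scoped PowerSeries.WithPiTopology

namespace ClusterMethod

/-! ### Permutations, peaks and consecutive patterns

A permutation of length `n` is an `Equiv.Perm (Fin n)`; letters and positions are counted from `0`.
-/

/-- The set of all permutations of all lengths. -/
abbrev AllPerm : Type := Σ m : ℕ, Equiv.Perm (Fin m)

/-- Standardization of a word with distinct letters: each letter is replaced by its rank,
the ranks being counted from `0`. -/
def std {m : ℕ} (w : Fin m → ℕ) : Fin m → ℕ :=
  fun a => (Finset.univ.filter fun b => w b < w a).card

/-- The factor of length `m` of the permutation `π` that starts at position `i`. -/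
def factor {n : ℕ} (π : Equiv.Perm (Fin n)) (i m : ℕ) (h : i + m ≤ n) : Fin m → ℕ :=
  fun a => (π ⟨i + a, by omega⟩ : ℕ)

/-- The consecutive pattern `σ` occurs in `π` at position `i`: the factor of `π` that starts at
position `i` and is as long as `σ` has standardization `σ`. -/
def OccursAt {m n : ℕ} (σ : Equiv.Perm (Fin m)) (π : Equiv.Perm (Fin n)) (i : ℕ) : Prop :=
  ∃ h : i + m ≤ n, std (factor π i m h) = fun a => (σ a : ℕ)

open scoped Classical in
/-- The finite set of all pairs `(i, σ)` with `σ ∈ Γ` occurring in `π` at position `i`.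
(The bounds on `i` and on the length of `σ` hold automatically, see `mem_occurrences`.) -/
noncomputable def occurrences (Γ : Set AllPerm) {n : ℕ} (π : Equiv.Perm (Fin n)) :
    Finset (ℕ × AllPerm) :=
  (Finset.range (n + 1) ×ˢ
    ((Finset.range (n + 1)).sigma fun m => (Finset.univ : Finset (Equiv.Perm (Fin m))))).filter
    fun p => p.2 ∈ Γ ∧ OccursAt p.2.2 π p.1

theorem mem_occurrences (Γ : Set AllPerm) {n : ℕ} (π : Equiv.Perm (Fin n)) (p : ℕ × AllPerm) :
    p ∈ occurrences Γ π ↔ p.2 ∈ Γ ∧ OccursAt p.2.2 π p.1 := by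
  classical
  simp only [occurrences, Finset.mem_filter, Finset.mem_product, Finset.mem_sigma,
    Finset.mem_range, Finset.mem_univ, and_true, and_iff_right_iff_imp]
  rintro ⟨-, h, -⟩
  omega

/-- The number of occurrences in `π` of patterns in `Γ`. -/
noncomputable def occ (Γ : Set AllPerm) {n : ℕ} (π : Equiv.Perm (Fin n)) : ℕ :=
  (occurrences Γ π).card

/-- The number of peaks of `π`: the interior positions `i` with `π (i-1) < π i > π (i+1)`. -/
def pk {n : ℕ} (π : Equiv.Perm (Fin n)) : ℕ :=
  (Finset.univ.filter fun i : Fin n =>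
    ∃ _ : 0 < (i : ℕ), ∃ h : (i : ℕ) + 1 < n,
      π ⟨(i : ℕ) - 1, by omega⟩ < π i ∧ π ⟨(i : ℕ) + 1, h⟩ < π i).card

/-- The inverse peak number. -/
def ipk {n : ℕ} (π : Equiv.Perm (Fin n)) : ℕ := pk π⁻¹

/-! ### Marked permutations and clusters -/

/-- A permutation together with a finite set of pairs (position, pattern). -/
structure Marked where
  len : ℕ
  perm : Equiv.Perm (Fin len)
  marks : Finset (ℕ × AllPerm)

/-- `c` is a marked permutation with respect to `Γ`: the marks are marked occurrences of patterns
in `Γ`. -/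
def Marked.IsMarkedPerm (Γ : Set AllPerm) (c : Marked) : Prop :=
  c.marks ⊆ occurrences Γ c.perm

open scoped Classical in
/-- `c` is a concatenation of `a` and `b`: the first `a.len` letters of `c` have standardization
`a`, the remaining `b.len` letters have standardization `b`, and the marks of `c` are those of `a`
together with those of `b` moved to the right by `a.len`. -/
def Marked.IsConcat (c a b : Marked) : Prop :=
  c.len = a.len + b.len ∧ OccursAt a.perm c.perm 0 ∧ OccursAt b.perm c.perm a.len ∧
    c.marks = a.marks ∪ b.marks.image fun p => (a.len + p.1, p.2)

/-- A `Γ`-cluster: a marked permutation that is not a concatenation of two nonempty marked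
permutations. -/
def Marked.IsCluster (Γ : Set AllPerm) (c : Marked) : Prop :=
  c.IsMarkedPerm Γ ∧
    ¬ ∃ a b : Marked, a.IsMarkedPerm Γ ∧ b.IsMarkedPerm Γ ∧ 0 < a.len ∧ 0 < b.len ∧ c.IsConcat a b

open scoped Classical in
/-- The set of all `Γ`-clusters on `π`, each given by its set of marked occurrences. -/
noncomputable def clusters (Γ : Set AllPerm) {n : ℕ} (π : Equiv.Perm (Fin n)) :
    Finset (Finset (ℕ × AllPerm)) :=
  (occurrences Γ π).powerset.filter fun T => Marked.IsCluster Γ ⟨n, π, T⟩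

/-! ### The polynomials, as functions on a commutative ring -/

/-- `P^{ipk}_{Γ,n}(s,t)`, equal to `1` for `n = 0` by convention. -/
noncomputable def Pipk {A : Type*} [CommRing A] (Γ : Set AllPerm) (n : ℕ) (s t : A) : A :=
  if n = 0 then 1 else ∑ π : Equiv.Perm (Fin n), s ^ occ Γ π * t ^ (ipk π + 1)

/-- `R^{ipk}_{Γ,k}(s,t)`. -/
noncomputable def Ripk {A : Type*} [CommRing A] (Γ : Set AllPerm) (k : ℕ) (s t : A) : A :=
  ∑ π : Equiv.Perm (Fin k), t ^ (ipk π + 1) * ∑ T ∈ clusters Γ π, s ^ T.card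

/-! ### Formal power series and the Hadamard product in `t` -/

/-- The ring `ℚ[s]` is discrete, so that convergence of formal power series over it (in the
product topology) means that every coefficient is eventually constant. -/
instance instTopologicalSpacePolyRat : TopologicalSpace (Polynomial ℚ) := ⊥

instance instDiscreteTopologyPolyRat : DiscreteTopology (Polynomial ℚ) := ⟨rfl⟩

/-- Formal power series in `t` whose coefficients are formal power series in `x` over `ℚ[s]`. -/
abbrev Series : Type := PowerSeries (PowerSeries (Polynomial ℚ))

/-- The variable `s`. -/
noncomputable def sVar : Series := PowerSeries.C (PowerSeries.C Polynomial.X)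

/-- The variable `x`. -/
noncomputable def xVar : Series := PowerSeries.C PowerSeries.X

/-- The variable `t`. -/
noncomputable def tVar : Series := PowerSeries.X

/-- The Hadamard product in `t`. -/
noncomputable def hadamard (f g : Series) : Series :=
  PowerSeries.mk fun n => PowerSeries.coeff n f * PowerSeries.coeff n g

/-- The `n`-fold Hadamard product of `f`; for `n = 0` it is the identity `1 + t + t² + ⋯` of the
Hadamard product. -/
noncomputable def hadamardPow (f : Series) : ℕ → Series
  | 0 => PowerSeries.mk fun _ => 1
  | n + 1 => hadamard (hadamardPow f n) f

/-- The quotient `f / g`; it is only used for invertible power series `g`. -/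
noncomputable def quot (f g : Series) : Series := f * Ring.inverse g

theorem isUnit_one_add_tVar : IsUnit (1 + tVar) := by
  rw [PowerSeries.isUnit_iff_constantCoeff]; simp [tVar]

theorem isUnit_one_sub_tVar : IsUnit (1 - tVar) := by
  rw [PowerSeries.isUnit_iff_constantCoeff]; simp [tVar]

theorem isUnit_two : IsUnit (2 : Series) := by
  have h := (isUnit_iff_ne_zero.mpr (two_ne_zero (α := ℚ))).map (algebraMap ℚ Series)
  rwa [map_ofNat] at h

theorem quot_mul_cancel (f : Series) {g : Series} (hg : IsUnit g) : quot f g * g = f := by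
  rw [quot, mul_assoc, Ring.inverse_mul_cancel g hg, mul_one]

/-- The series `u = 4t/(1+t)²`. -/
noncomputable def uSeries : Series := quot (4 * tVar) ((1 + tVar) ^ 2)

/-- The series `z = (1+t)x/(1-t)`. -/
noncomputable def zSeries : Series := quot ((1 + tVar) * xVar) (1 - tVar)

end ClusterMethod

open ClusterMethod

namespace ClusterMethod

/-! ### Standardization -/

/-! The Hadamard product acts coefficientwise, so the theorem is one identity `F = 1/(1 - C)` in `x`
for each power `t^m`. There `F` counts words over the `2m` letters `0, …, 2m - 1` by length,
weighted by `s ^ occ` of their signed standardization, and `C` counts the clusters on nonempty words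
in the same way, with weight `s - 1` per mark.

The identity is the cluster method for words. A marked word of positive length splits uniquely at
its first uncrossed cut into a cluster and a marked word (`add_one_pow_occ`). Signed standardization
commutes with taking factors (`stdFactor_wordPerm`), and the two factors of a word are independent,
so summing over words gives a convolution (`wordOccSum_eq`).

The substitutions `u`, `z` come from counting the words with signed standardization `π`. Read in the
order given by `π⁻¹`, such a word is a weakly increasing chain in which equal odd letters may stand
at ascents of `π⁻¹` and equal even letters at descents. The generating function in `t` of these
counts over `2m` letters depends only on the length and on `ipk π`: each step contributes
`(1+t)/(1-t)` and each peak a further `4t/(1+t)²` (`chain_recursion`,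
`halfSeries_mul_eq_chainSeries`). -/

theorem std_lt {m : ℕ} (w : Fin m → ℕ) (a : Fin m) : std w a < m := by
  have h : (Finset.univ.filter fun b => w b < w a) ⊂ (Finset.univ : Finset (Fin m)) := by
    rw [Finset.filter_ssubset]
    exact ⟨a, Finset.mem_univ a, lt_irrefl _⟩
  simpa [std] using Finset.card_lt_card h

theorem std_lt_std {m : ℕ} {w : Fin m → ℕ} {a b : Fin m} (h : w a < w b) : std w a < std w b := by
  apply Finset.card_lt_card
  rw [Finset.ssubset_iff_of_subset (Finset.monotone_filter_right _ fun c _ hc => lt_trans hc h)]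
  exact ⟨a, by simpa using h, by simp⟩

theorem std_lt_std_iff {m : ℕ} {w : Fin m → ℕ} (hw : Function.Injective w) {a b : Fin m} :
    std w a < std w b ↔ w a < w b := by
  refine ⟨fun h => ?_, std_lt_std⟩
  rcases lt_trichotomy (w a) (w b) with h' | h' | h'
  · exact h'
  · exact absurd h (by rw [hw h']; exact lt_irrefl _)
  · exact absurd h (std_lt_std h').not_gt

theorem std_congr {m : ℕ} {w w' : Fin m → ℕ} (h : ∀ a b, w a < w b ↔ w' a < w' b) :
    std w = std w' := by
  funext a
  simp only [std, h]

theorem std_coe_perm {m : ℕ} (σ : Equiv.Perm (Fin m)) :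
    (std fun a => (σ a : ℕ)) = fun a => (σ a : ℕ) := by
  funext a
  have : (Finset.univ.filter fun b => (σ b : ℕ) < (σ a : ℕ)).map σ.toEmbedding
      = Finset.Iio (σ a) := by
    ext x
    simp only [Finset.mem_map_equiv, Finset.mem_filter, Finset.mem_univ, true_and,
      Equiv.apply_symm_apply, Finset.mem_Iio, Fin.lt_def]
  rw [std, ← Finset.card_map σ.toEmbedding, this, Fin.card_Iio]

/-- A permutation is its own standardization, and standardization sees only comparisons. This
identifies standardizations without computing ranks. -/
theorem perm_eq_of_lt_iff_lt {m : ℕ} {σ τ : Equiv.Perm (Fin m)}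
    (h : ∀ a b, σ a < σ b ↔ τ a < τ b) : σ = τ := by
  have h' := (std_coe_perm σ).symm.trans ((std_congr h).trans (std_coe_perm τ))
  ext a
  exact congrFun h' a

/-- The standardization of a word with distinct letters, as a permutation. -/
noncomputable def stdPerm {m : ℕ} (w : Fin m → ℕ) (hw : Function.Injective w) :
    Equiv.Perm (Fin m) :=
  Equiv.ofBijective (fun a => ⟨std w a, std_lt w a⟩) <| Finite.injective_iff_bijective.mp <| by
    intro a b hab
    have hab' : std w a = std w b := congrArg Fin.val hab
    apply hw
    rcases lt_trichotomy (w a) (w b) with h | h | h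
    · exact absurd hab' (std_lt_std h).ne
    · exact h
    · exact absurd hab' (std_lt_std h).ne'

theorem stdPerm_lt_iff {m : ℕ} {w : Fin m → ℕ} (hw : Function.Injective w) {a b : Fin m} :
    stdPerm w hw a < stdPerm w hw b ↔ w a < w b :=
  std_lt_std_iff hw

/-- The inverse lists positions by increasing rank of their letters. This is why the inverse peak
number, rather than the peak number, governs the count of words. -/
theorem stdPerm_eq_iff {m : ℕ} {w : Fin m → ℕ} (hw : Function.Injective w)
    {σ : Equiv.Perm (Fin m)} : stdPerm w hw = σ ↔ StrictMono fun i => w (σ⁻¹ i) := by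
  constructor
  · rintro rfl i j hij
    rw [← stdPerm_lt_iff hw]
    simpa using hij
  · intro h
    apply perm_eq_of_lt_iff_lt
    intro a b
    rw [stdPerm_lt_iff, ← h.lt_iff_lt]
    simp

theorem factor_injective {n : ℕ} (π : Equiv.Perm (Fin n)) (i m : ℕ) (h : i + m ≤ n) :
    Function.Injective (factor π i m h) := by
  intro a b hab
  have := π.injective (Fin.ext hab)
  simpa [Fin.ext_iff] using this

theorem occursAt_iff {m n : ℕ} {σ : Equiv.Perm (Fin m)} {π : Equiv.Perm (Fin n)} {i : ℕ} :
    OccursAt σ π i ↔ ∃ h : i + m ≤ n, ∀ a b : Fin m,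
      σ a < σ b ↔ π ⟨i + a, by omega⟩ < π ⟨i + b, by omega⟩ := by
  constructor
  · rintro ⟨h, hs⟩
    refine ⟨h, fun a b => ?_⟩
    rw [Fin.lt_def, ← congrFun hs a, ← congrFun hs b, std_lt_std_iff (factor_injective π i m h)]
    rfl
  · rintro ⟨h, hs⟩
    refine ⟨h, ?_⟩
    rw [← std_coe_perm σ]
    exact std_congr fun a b => (hs a b).symm

/-- The standardization of a factor of a permutation. -/
noncomputable def stdFactor {n : ℕ} (π : Equiv.Perm (Fin n)) (i m : ℕ) (h : i + m ≤ n) :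
    Equiv.Perm (Fin m) :=
  stdPerm (factor π i m h) (factor_injective π i m h)

theorem stdFactor_lt_iff {n : ℕ} (π : Equiv.Perm (Fin n)) {i m : ℕ} (h : i + m ≤ n)
    (a b : Fin m) : stdFactor π i m h a < stdFactor π i m h b ↔
      π ⟨i + a, by omega⟩ < π ⟨i + b, by omega⟩ :=
  stdPerm_lt_iff _

theorem occursAt_stdFactor {n : ℕ} (π : Equiv.Perm (Fin n)) {i m : ℕ} (h : i + m ≤ n) :
    OccursAt (stdFactor π i m h) π i :=
  occursAt_iff.mpr ⟨h, stdFactor_lt_iff π h⟩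

theorem occursAt_stdFactor_iff {k n : ℕ} {σ : Equiv.Perm (Fin k)} {π : Equiv.Perm (Fin n)}
    {i m j : ℕ} (h : i + m ≤ n) :
    OccursAt σ (stdFactor π i m h) j ↔ j + k ≤ m ∧ OccursAt σ π (i + j) := by
  rw [occursAt_iff, occursAt_iff]
  simp only [stdFactor_lt_iff, add_assoc]
  constructor
  · rintro ⟨h1, h2⟩
    exact ⟨h1, by omega, h2⟩
  · rintro ⟨h1, _, h2⟩
    exact ⟨h1, h2⟩

theorem mem_occurrences_stdFactor (Γ : Set AllPerm) {n : ℕ} (π : Equiv.Perm (Fin n)) {i m : ℕ}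
    (h : i + m ≤ n) (p : ℕ × AllPerm) :
    p ∈ occurrences Γ (stdFactor π i m h) ↔
      p.1 + p.2.1 ≤ m ∧ (i + p.1, p.2) ∈ occurrences Γ π := by
  rw [mem_occurrences, mem_occurrences, occursAt_stdFactor_iff]
  tauto

theorem add_length_le_of_mem_occurrences {Γ : Set AllPerm} {n : ℕ} {π : Equiv.Perm (Fin n)}
    {p : ℕ × AllPerm} (hp : p ∈ occurrences Γ π) : p.1 + p.2.1 ≤ n :=
  ((mem_occurrences Γ π p).mp hp).2.1

/-! ### Decomposition of marked permutations -/

/-- The mark `p` covers letters on both sides of the cut after the first `a` letters. -/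
def Crosses (p : ℕ × AllPerm) (a : ℕ) : Prop := p.1 < a ∧ a < p.1 + p.2.1

theorem not_crosses_iff {p : ℕ × AllPerm} {a : ℕ} :
    ¬ Crosses p a ↔ p.1 + p.2.1 ≤ a ∨ a ≤ p.1 := by
  simp only [Crosses]
  omega

/-- Moving a mark to the right by `a`. -/
def shiftMark (a : ℕ) (p : ℕ × AllPerm) : ℕ × AllPerm := (a + p.1, p.2)

/-- Moving a mark to the left by `a`. -/
def unshiftMark (a : ℕ) (p : ℕ × AllPerm) : ℕ × AllPerm := (p.1 - a, p.2)

theorem unshiftMark_shiftMark (a : ℕ) (p : ℕ × AllPerm) : unshiftMark a (shiftMark a p) = p := by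
  simp [unshiftMark, shiftMark]

theorem shiftMark_unshiftMark {a : ℕ} {p : ℕ × AllPerm} (h : a ≤ p.1) :
    shiftMark a (unshiftMark a p) = p := by
  simp [unshiftMark, shiftMark, h]

theorem shiftMark_injective (a : ℕ) : Function.Injective (shiftMark a) :=
  Function.LeftInverse.injective (unshiftMark_shiftMark a)

open scoped Classical in
/-- The marks in the first `a` letters. -/
noncomputable def leftMarks (a : ℕ) (T : Finset (ℕ × AllPerm)) : Finset (ℕ × AllPerm) :=
  T.filter fun p => p.1 + p.2.1 ≤ a

open scoped Classical in
/-- The marks after the first `a` letters. -/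
noncomputable def rightMarks (a : ℕ) (T : Finset (ℕ × AllPerm)) : Finset (ℕ × AllPerm) :=
  (T.filter fun p => a ≤ p.1).image (unshiftMark a)

open scoped Classical in
/-- The marks of a concatenation. -/
noncomputable def joinMarks (a : ℕ) (S U : Finset (ℕ × AllPerm)) : Finset (ℕ × AllPerm) :=
  S ∪ U.image (shiftMark a)

theorem mem_leftMarks {a : ℕ} {T : Finset (ℕ × AllPerm)} {p : ℕ × AllPerm} :
    p ∈ leftMarks a T ↔ p ∈ T ∧ p.1 + p.2.1 ≤ a := by
  simp [leftMarks]

theorem mem_rightMarks {a : ℕ} {T : Finset (ℕ × AllPerm)} {p : ℕ × AllPerm} :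
    p ∈ rightMarks a T ↔ shiftMark a p ∈ T := by
  simp only [rightMarks, Finset.mem_image, Finset.mem_filter]
  constructor
  · rintro ⟨q, ⟨hq, ha⟩, rfl⟩
    rwa [shiftMark_unshiftMark ha]
  · intro h
    exact ⟨shiftMark a p, ⟨h, Nat.le_add_right _ _⟩, unshiftMark_shiftMark a p⟩

theorem mem_joinMarks {a : ℕ} {S U : Finset (ℕ × AllPerm)} {p : ℕ × AllPerm} :
    p ∈ joinMarks a S U ↔ p ∈ S ∨ ∃ q ∈ U, shiftMark a q = p := by
  simp [joinMarks]

theorem joinMarks_leftMarks_rightMarks {a : ℕ} {T : Finset (ℕ × AllPerm)}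
    (h : ∀ p ∈ T, ¬ Crosses p a) : joinMarks a (leftMarks a T) (rightMarks a T) = T := by
  ext p
  simp only [mem_joinMarks, mem_leftMarks, mem_rightMarks]
  constructor
  · rintro (h | ⟨q, hq, rfl⟩)
    · exact h.1
    · exact hq
  · intro hp
    rcases not_crosses_iff.mp (h p hp) with h' | h'
    · exact Or.inl ⟨hp, h'⟩
    · exact Or.inr ⟨unshiftMark a p, by rwa [shiftMark_unshiftMark h'], shiftMark_unshiftMark h'⟩

theorem leftMarks_subset_occurrences {Γ : Set AllPerm} {n a : ℕ} {π : Equiv.Perm (Fin n)}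
    {T : Finset (ℕ × AllPerm)} (hT : T ⊆ occurrences Γ π) (h : 0 + a ≤ n) :
    leftMarks a T ⊆ occurrences Γ (stdFactor π 0 a h) := by
  intro p hp
  rw [mem_leftMarks] at hp
  rw [mem_occurrences_stdFactor, zero_add]
  exact ⟨hp.2, hT hp.1⟩

theorem rightMarks_subset_occurrences {Γ : Set AllPerm} {n a b : ℕ} {π : Equiv.Perm (Fin n)}
    {T : Finset (ℕ × AllPerm)} (hT : T ⊆ occurrences Γ π) (h : a + b = n) :
    rightMarks a T ⊆ occurrences Γ (stdFactor π a b h.le) := by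
  intro p hp
  rw [mem_rightMarks] at hp
  rw [mem_occurrences_stdFactor]
  have := add_length_le_of_mem_occurrences (hT hp)
  simp only [shiftMark] at this
  exact ⟨by omega, hT hp⟩

/-- The permutation can be cut anywhere, by standardizing both factors; only a mark lying across the
cut prevents the marks from being divided as well. -/
theorem isCluster_iff {Γ : Set AllPerm} {n : ℕ} {π : Equiv.Perm (Fin n)}
    {T : Finset (ℕ × AllPerm)} (hT : T ⊆ occurrences Γ π) :
    Marked.IsCluster Γ ⟨n, π, T⟩ ↔ ∀ a, 0 < a → a < n → ∃ p ∈ T, Crosses p a := by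
  constructor
  · rintro ⟨-, h⟩ a ha han
    by_contra! hc
    refine h ⟨⟨a, stdFactor π 0 a (by omega), leftMarks a T⟩,
      ⟨n - a, stdFactor π a (n - a) (by omega), rightMarks a T⟩,
      leftMarks_subset_occurrences hT _, rightMarks_subset_occurrences hT (Nat.add_sub_cancel' han.le), ha,
      Nat.sub_pos_of_lt han, (Nat.add_sub_cancel' han.le).symm, occursAt_stdFactor π _,
      occursAt_stdFactor π _, (joinMarks_leftMarks_rightMarks hc).symm⟩
  · refine fun h => ⟨hT, ?_⟩
    rintro ⟨a, b, ha, hb, ha0, hb0, hlen, -, -, hm⟩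
    obtain ⟨p, hp, hc⟩ := h a.len ha0 (by simp only at hlen; omega)
    refine not_crosses_iff.mpr ?_ hc
    simp only at hm
    rw [hm, Finset.mem_union, Finset.mem_image] at hp
    rcases hp with hp | ⟨q, -, rfl⟩
    · exact Or.inl (add_length_le_of_mem_occurrences (ha hp))
    · exact Or.inr (Nat.le_add_right _ _)

theorem mem_clusters_iff {Γ : Set AllPerm} {n : ℕ} {π : Equiv.Perm (Fin n)}
    {T : Finset (ℕ × AllPerm)} : T ∈ clusters Γ π ↔
      T ⊆ occurrences Γ π ∧ ∀ a, 0 < a → a < n → ∃ p ∈ T, Crosses p a := by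
  classical
  rw [clusters, Finset.mem_filter, Finset.mem_powerset, and_congr_right_iff]
  exact isCluster_iff

/-- `a` is the first place at which a set of marks can be cut. -/
def IsFirstCut (T : Finset (ℕ × AllPerm)) (a : ℕ) : Prop :=
  (∀ p ∈ T, ¬ Crosses p a) ∧ ∀ b, 0 < b → b < a → ∃ p ∈ T, Crosses p b

theorem IsFirstCut.eq {T : Finset (ℕ × AllPerm)} {a b : ℕ} (ha : IsFirstCut T a)
    (hb : IsFirstCut T b) (ha0 : 0 < a) (hb0 : 0 < b) : a = b := by
  rcases lt_trichotomy a b with h | h | h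
  · obtain ⟨p, hp, hc⟩ := hb.2 a ha0 h
    exact absurd hc (ha.1 p hp)
  · exact h
  · obtain ⟨p, hp, hc⟩ := ha.2 b hb0 h
    exact absurd hc (hb.1 p hp)

theorem exists_isFirstCut {Γ : Set AllPerm} {n : ℕ} {π : Equiv.Perm (Fin n)} (hn : 0 < n)
    {T : Finset (ℕ × AllPerm)} (hT : T ⊆ occurrences Γ π) :
    ∃ a, 0 < a ∧ a ≤ n ∧ IsFirstCut T a := by
  classical
  have hex : ∃ a, 0 < a ∧ ∀ p ∈ T, ¬ Crosses p a :=
    ⟨n, hn, fun p hp => not_crosses_iff.mpr (Or.inl (add_length_le_of_mem_occurrences (hT hp)))⟩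
  refine ⟨Nat.find hex, (Nat.find_spec hex).1, ?_, (Nat.find_spec hex).2, fun b hb hlt => ?_⟩
  · exact Nat.find_min' hex ⟨hn, fun p hp =>
      not_crosses_iff.mpr (Or.inl (add_length_le_of_mem_occurrences (hT hp)))⟩
  · have := Nat.find_min hex hlt
    push Not at this
    exact this hb

/-- The generating polynomial of the clusters on `π`. -/
noncomputable def clusterSum {A : Type*} [CommRing A] (Γ : Set AllPerm) (y : A) {n : ℕ}
    (π : Equiv.Perm (Fin n)) : A :=
  ∑ T ∈ clusters Γ π, y ^ T.card

/-- Each occurrence is either marked, with weight `y`, or unmarked, with weight `1`. -/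
theorem sum_powerset_occurrences {A : Type*} [CommRing A] (Γ : Set AllPerm) (y : A) {n : ℕ}
    (π : Equiv.Perm (Fin n)) :
    ∑ T ∈ (occurrences Γ π).powerset, y ^ T.card = (y + 1) ^ occ Γ π := by
  rw [occ, ← Finset.sum_pow_mul_eq_add_pow]
  simp

section

variable {A : Type*} [CommRing A] {Γ : Set AllPerm} {n a b : ℕ} {π : Equiv.Perm (Fin n)}
  {S U T : Finset (ℕ × AllPerm)}

/-- What matters here is that the empty pattern is excluded: marked at position `a`, it would belong
to both sides of the cut. -/
theorem leftMarks_joinMarks (hΓ : ∀ σ ∈ Γ, 2 ≤ σ.1) (h : a + b = n)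
    (hS : S ⊆ occurrences Γ (stdFactor π 0 a (by omega)))
    (hU : U ⊆ occurrences Γ (stdFactor π a b h.le)) : leftMarks a (joinMarks a S U) = S := by
  ext p
  rw [mem_leftMarks, mem_joinMarks]
  constructor
  · rintro ⟨hp | ⟨q, hq, rfl⟩, hle⟩
    · exact hp
    · have := hΓ _ ((mem_occurrences _ _ _).mp (hU hq)).1
      simp only [shiftMark] at hle
      omega
  · intro hp
    exact ⟨Or.inl hp, add_length_le_of_mem_occurrences (hS hp)⟩

theorem rightMarks_joinMarks (hΓ : ∀ σ ∈ Γ, 2 ≤ σ.1) (h : a + b = n)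
    (hS : S ⊆ occurrences Γ (stdFactor π 0 a (by omega))) :
    rightMarks a (joinMarks a S U) = U := by
  ext p
  rw [mem_rightMarks, mem_joinMarks]
  constructor
  · rintro (hp | ⟨q, hq, hqp⟩)
    · have h1 := hΓ _ ((mem_occurrences _ _ _).mp (hS hp)).1
      have h2 := add_length_le_of_mem_occurrences (hS hp)
      simp only [shiftMark] at h1 h2
      omega
    · rwa [← shiftMark_injective a hqp]
  · intro hp
    exact Or.inr ⟨p, hp, rfl⟩

theorem disjoint_image_shiftMark [DecidableEq (ℕ × AllPerm)] (hΓ : ∀ σ ∈ Γ, 2 ≤ σ.1)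
    (h : 0 + a ≤ n) (hS : S ⊆ occurrences Γ (stdFactor π 0 a h)) :
    Disjoint S (U.image (shiftMark a)) := by
  rw [Finset.disjoint_left]
  intro p hp hq
  obtain ⟨q, -, rfl⟩ := Finset.mem_image.mp hq
  have h1 := hΓ _ ((mem_occurrences _ _ _).mp (hS hp)).1
  have h2 := add_length_le_of_mem_occurrences (hS hp)
  simp only [shiftMark] at h1 h2
  omega

theorem joinMarks_subset_occurrences (h : a + b = n)
    (hS : S ⊆ occurrences Γ (stdFactor π 0 a (by omega)))
    (hU : U ⊆ occurrences Γ (stdFactor π a b h.le)) : joinMarks a S U ⊆ occurrences Γ π := by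
  intro p hp
  rcases mem_joinMarks.mp hp with hp | ⟨q, hq, rfl⟩
  · simpa using ((mem_occurrences_stdFactor _ _ _ _).mp (hS hp)).2
  · exact ((mem_occurrences_stdFactor _ _ _ _).mp (hU hq)).2

theorem isFirstCut_joinMarks (h : a + b = n) (hS : S ∈ clusters Γ (stdFactor π 0 a (by omega))) :
    IsFirstCut (joinMarks a S U) a := by
  rw [mem_clusters_iff] at hS
  refine ⟨fun p hp => not_crosses_iff.mpr ?_, fun b hb hba => ?_⟩
  · rcases mem_joinMarks.mp hp with hp | ⟨q, hq, rfl⟩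
    · exact Or.inl (add_length_le_of_mem_occurrences (hS.1 hp))
    · exact Or.inr (Nat.le_add_right _ _)
  · obtain ⟨p, hp, hc⟩ := hS.2 b hb hba
    exact ⟨p, mem_joinMarks.mpr (Or.inl hp), hc⟩

theorem leftMarks_mem_clusters (hT : T ⊆ occurrences Γ π) (hf : IsFirstCut T a) (h : 0 + a ≤ n) :
    leftMarks a T ∈ clusters Γ (stdFactor π 0 a h) := by
  rw [mem_clusters_iff]
  refine ⟨leftMarks_subset_occurrences hT h, fun b hb hba => ?_⟩
  obtain ⟨p, hp, hc⟩ := hf.2 b hb hba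
  refine ⟨p, mem_leftMarks.mpr ⟨hp, ?_⟩, hc⟩
  rcases not_crosses_iff.mp (hf.1 p hp) with h' | h'
  · exact h'
  · have := hc.1
    omega

-- That `a` is the first cut says exactly that the left marks form a cluster; the right marks are
-- then arbitrary, and their sum is a power of `y + 1`.
open scoped Classical in
theorem sum_isFirstCut (hΓ : ∀ σ ∈ Γ, 2 ≤ σ.1) (y : A) (h : a + b = n) :
    ∑ T ∈ (occurrences Γ π).powerset with IsFirstCut T a, y ^ T.card =
      clusterSum Γ y (stdFactor π 0 a (by omega)) *
        (y + 1) ^ occ Γ (stdFactor π a b h.le) := by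
  rw [← sum_powerset_occurrences, clusterSum, Finset.sum_mul_sum, ← Finset.sum_product']
  refine (Finset.sum_nbij' (fun q => joinMarks a q.1 q.2)
    (fun T => (leftMarks a T, rightMarks a T)) ?_ ?_ ?_ ?_ ?_).symm
  · rintro ⟨S, U⟩ hq
    simp only [Finset.mem_product, Finset.mem_powerset] at hq
    exact Finset.mem_filter.mpr ⟨Finset.mem_powerset.mpr
      (joinMarks_subset_occurrences h (mem_clusters_iff.mp hq.1).1 hq.2),
      isFirstCut_joinMarks h hq.1⟩
  · intro T hT
    simp only [Finset.mem_filter, Finset.mem_powerset] at hT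
    exact Finset.mem_product.mpr ⟨leftMarks_mem_clusters hT.1 hT.2 _,
      Finset.mem_powerset.mpr (rightMarks_subset_occurrences hT.1 h)⟩
  · rintro ⟨S, U⟩ hq
    simp only [Finset.mem_product, Finset.mem_powerset] at hq
    have hS := (mem_clusters_iff.mp hq.1).1
    exact Prod.ext (leftMarks_joinMarks hΓ h hS hq.2) (rightMarks_joinMarks hΓ h hS)
  · intro T hT
    simp only [Finset.mem_filter] at hT
    exact joinMarks_leftMarks_rightMarks hT.2.1
  · rintro ⟨S, U⟩ hq
    simp only [Finset.mem_product] at hq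
    have hS := (mem_clusters_iff.mp hq.1).1
    rw [joinMarks, Finset.card_union_of_disjoint (disjoint_image_shiftMark hΓ _ hS),
      Finset.card_image_of_injective _ (shiftMark_injective a), pow_add]

end

/-- Every marked permutation of positive length is uniquely the concatenation of a cluster of
positive length and a marked permutation. -/
theorem add_one_pow_occ {A : Type*} [CommRing A] {Γ : Set AllPerm} (hΓ : ∀ σ ∈ Γ, 2 ≤ σ.1) (y : A)
    {n : ℕ} (hn : 0 < n) (π : Equiv.Perm (Fin n)) :
    (y + 1) ^ occ Γ π = ∑ a : Fin n, clusterSum Γ y (stdFactor π 0 (a + 1) (by omega)) *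
        (y + 1) ^ occ Γ (stdFactor π (a + 1) (n - (a + 1)) (by omega)) := by
  classical
  have h (a : Fin n) := sum_isFirstCut (π := π) hΓ y (a := a + 1) (b := n - (a + 1)) (by omega)
  rw [Finset.sum_congr rfl fun a _ => (h a).symm, ← sum_powerset_occurrences]
  simp only [Finset.sum_filter]
  rw [Finset.sum_comm]
  refine Finset.sum_congr rfl fun T hT => ?_
  obtain ⟨a, ha0, han, ha⟩ := exists_isFirstCut hn (Finset.mem_powerset.mp hT)
  -- After the exchange of sums, each mark set contributes only at its unique first cut `a`; the
  -- index is `a - 1` because index `i` stands for the cut `i + 1`.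
  rw [Finset.sum_eq_single ⟨a - 1, by omega⟩]
  · rw [if_pos]
    simpa [Nat.sub_add_cancel ha0] using ha
  · intro b _ hb
    rw [if_neg]
    intro hb'
    apply hb
    have := hb'.eq ha (Nat.succ_pos _) ha0
    ext
    simp only
    omega
  · simp

/-! ### Signed standardization of words -/

/-- An injective refinement of a word `v`, the order of which is that of the letters of `v`, equal
odd letters being ordered from left to right and equal even letters from right to left. -/
def signedKey {n : ℕ} (v : Fin n → ℕ) (i : Fin n) : ℕ :=
  v i * n + if Odd (v i) then (i : ℕ) else n - 1 - i

/-- The tie-breaking summand is less than `n`, so the key orders positions lexicographically: letter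
first, then position or reversed position. -/
theorem signedKey_lt_iff {n : ℕ} (v : Fin n → ℕ) (i j : Fin n) :
    signedKey v i < signedKey v j ↔
      v i < v j ∨ v i = v j ∧ if Odd (v i) then i < j else j < i := by
  have key : ∀ {x y p q : ℕ}, x < y → p < n → x * n + p < y * n + q := by
    intro x y p q hxy hp
    calc x * n + p < x * n + n := by omega
      _ = (x + 1) * n := by ring
      _ ≤ y * n := Nat.mul_le_mul_right n hxy
      _ ≤ y * n + q := Nat.le_add_right _ _
  have hlt : ∀ k : Fin n, (if Odd (v k) then (k : ℕ) else n - 1 - k) < n := by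
    intro k
    split_ifs <;> omega
  simp only [signedKey]
  rcases lt_trichotomy (v i) (v j) with h | h | h
  · simp [key h (hlt i), h]
  · rw [h]
    split_ifs <;> simp only [add_lt_add_iff_left, lt_irrefl, false_or, true_and, Fin.lt_def]
    omega
  · simp [(key h (hlt j)).le, h.not_gt, h.ne']

theorem signedKey_injective {n : ℕ} (v : Fin n → ℕ) : Function.Injective (signedKey v) := by
  intro i j h
  have h1 := (signedKey_lt_iff v i j).not.mp h.not_lt
  have h2 := (signedKey_lt_iff v j i).not.mp h.symm.not_lt
  have hv : v i = v j := by omega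
  rw [hv] at h1 h2
  split_ifs at h1 h2 <;> simp at h1 h2 <;> omega

/-- The signed standardization of a word. -/
noncomputable def wordPerm {n : ℕ} (v : Fin n → ℕ) : Equiv.Perm (Fin n) :=
  stdPerm (signedKey v) (signedKey_injective v)

/-- The keys themselves depend on `n` and on absolute positions, but their order uses only letters
and relative positions, which survive passage to a factor. -/
theorem stdFactor_wordPerm {n : ℕ} (v : Fin n → ℕ) (i m : ℕ) (h : i + m ≤ n) :
    stdFactor (wordPerm v) i m h = wordPerm fun a : Fin m => v ⟨i + a, by omega⟩ := by
  apply perm_eq_of_lt_iff_lt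
  intro a b
  rw [stdFactor_lt_iff]
  simp only [wordPerm, stdPerm_lt_iff, signedKey_lt_iff]
  simp only [Fin.lt_def, add_lt_add_iff_left]

/-- The number of words of length `n` in the letters `0, …, M - 1` with signed
standardization `π`. -/
noncomputable def wordCount (M : ℕ) {n : ℕ} (π : Equiv.Perm (Fin n)) : ℕ :=
  (Finset.univ.filter fun v : Fin n → Fin M => wordPerm (fun i => (v i : ℕ)) = π).card

theorem sum_wordPerm {A : Type*} [CommRing A] (M n : ℕ) (F : Equiv.Perm (Fin n) → A) :
    ∑ v : Fin n → Fin M, F (wordPerm fun i => (v i : ℕ)) = ∑ π, wordCount M π * F π := by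
  rw [← Finset.sum_fiberwise Finset.univ fun v : Fin n → Fin M => wordPerm fun i => (v i : ℕ)]
  refine Finset.sum_congr rfl fun π _ => ?_
  rw [wordCount, ← nsmul_eq_mul]
  refine Finset.sum_eq_card_nsmul fun v hv => ?_
  rw [(Finset.mem_filter.mp hv).2]

/-- Any two words can be concatenated in exactly one way, whereas permutations have many
concatenations. Passing to words thus turns the decomposition into a product. -/
theorem sum_words_split {A X : Type*} [CommRing A] [Fintype X] {a b n : ℕ} (h : a + b = n)
    (F : (Fin a → X) → A) (G : (Fin b → X) → A) :
    ∑ v : Fin n → X, F (fun i => v ⟨0 + i, by omega⟩) * G (fun i => v ⟨a + i, by omega⟩) =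
      (∑ v, F v) * ∑ v, G v := by
  subst h
  rw [Finset.sum_mul_sum, ← Finset.sum_product', Finset.univ_product_univ,
    ← (Fin.appendEquiv a b).sum_comp]
  refine Finset.sum_congr rfl fun p _ => ?_
  congr 2
  · funext i
    have hi : (⟨0 + i, by omega⟩ : Fin (a + b)) = Fin.castAdd b i := Fin.ext (Nat.zero_add _)
    rw [hi]
    exact Fin.append_left p.1 p.2 i
  · funext i
    exact Fin.append_right p.1 p.2 i

/-- The weighted count of all words of length `n`. -/
noncomputable def wordOccSum {A : Type*} [CommRing A] (Γ : Set AllPerm) (s : A) (M n : ℕ) : A :=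
  ∑ π : Equiv.Perm (Fin n), wordCount M π * s ^ occ Γ π

/-- The weighted count of all clusters on words of length `n`. -/
noncomputable def wordClusterSum {A : Type*} [CommRing A] (Γ : Set AllPerm) (s : A) (M n : ℕ) : A :=
  ∑ π : Equiv.Perm (Fin n), wordCount M π * clusterSum Γ s π

theorem wordOccSum_eq {A : Type*} [CommRing A] {Γ : Set AllPerm} (hΓ : ∀ σ ∈ Γ, 2 ≤ σ.1) (s : A)
    (M : ℕ) {n : ℕ} (hn : 0 < n) :
    wordOccSum Γ s M n =
      ∑ a : Fin n, wordClusterSum Γ (s - 1) M (a + 1) * wordOccSum Γ s M (n - (a + 1)) := by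
  rw [wordOccSum, ← sum_wordPerm M n fun π => s ^ occ Γ π]
  have h := fun v : Fin n → Fin M => add_one_pow_occ hΓ (s - 1) hn (wordPerm fun i => (v i : ℕ))
  simp only [sub_add_cancel] at h
  simp only [h]
  rw [Finset.sum_comm]
  refine Finset.sum_congr rfl fun a _ => ?_
  rw [wordClusterSum, wordOccSum, ← sum_wordPerm M _ fun π => clusterSum Γ (s - 1) π,
    ← sum_wordPerm M _ fun π => s ^ occ Γ π]
  simp only [stdFactor_wordPerm]
  exact sum_words_split (Nat.add_sub_cancel' (Nat.succ_le_of_lt a.2))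
    (fun v : Fin (a + 1) → Fin M => clusterSum Γ (s - 1) (wordPerm fun i => (v i : ℕ)))
    (fun v => s ^ occ Γ (wordPerm fun i => (v i : ℕ)))

/-! ### Words with given signed standardization -/

/-- `k` may follow `j` in a chain; equality is allowed if the parity of the letter is odd
and `p` holds, or even and `p` fails. -/
def ChainStep (p : Prop) (j k : ℕ) : Prop := j < k ∨ j = k ∧ (Odd k ↔ p)

/-- A weakly increasing sequence, equality being governed by `ε`. -/
def IsSignedChain (ε : ℕ → Prop) {n : ℕ} (f : Fin (n + 1) → ℕ) : Prop :=
  ∀ i : Fin n, ChainStep (ε i) (f i.castSucc) (f i.succ)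

open scoped Classical in
/-- The number of chains of length `n + 1` that end in `k`. -/
noncomputable def chainCount (ε : ℕ → Prop) : ℕ → ℕ → ℕ
  | 0, _ => 1
  | n + 1, k => (∑ j ∈ Finset.range k, chainCount ε n j) +
      if (Odd k ↔ ε n) then chainCount ε n k else 0

theorem isSignedChain_snoc {ε : ℕ → Prop} {n M : ℕ} (f : Fin (n + 1) → Fin M) (x : Fin M) :
    (IsSignedChain ε fun i => ((Fin.snoc f x : Fin (n + 2) → Fin M) i : ℕ)) ↔
      (IsSignedChain ε fun i => (f i : ℕ)) ∧ ChainStep (ε n) (f (Fin.last n)) x := by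
  simp only [IsSignedChain]
  rw [Fin.forall_fin_succ']
  simp only [Fin.val_castSucc, Fin.snoc_castSucc, Fin.val_last, Fin.succ_last, Fin.snoc_last,
    Fin.succ_castSucc]

open scoped Classical in
theorem sum_chainStep (p : Prop) {M : ℕ} (k : Fin M) (g : ℕ → ℕ) :
    ∑ j : Fin M, (if ChainStep p j k then g j else 0) =
      (∑ j ∈ Finset.range k, g j) + if (Odd (k : ℕ) ↔ p) then g k else 0 := by
  rw [Fin.sum_univ_eq_sum_range (fun j => if ChainStep p j k then g j else 0) M,
    ← Finset.sum_filter]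
  have h : (Finset.range M).filter (fun j => ChainStep p j k) =
      Finset.range k ∪ if (Odd (k : ℕ) ↔ p) then {(k : ℕ)} else ∅ := by
    ext j
    have := k.2
    split_ifs with hp <;> simp [ChainStep, hp] <;> omega
  rw [h, Finset.sum_union]
  · split_ifs <;> simp
  · split_ifs <;> simp

open scoped Classical in
theorem card_chains (ε : ℕ → Prop) (M n : ℕ) (k : Fin M) :
    (Finset.univ.filter fun f : Fin (n + 1) → Fin M =>
      (IsSignedChain ε fun i => (f i : ℕ)) ∧ f (Fin.last n) = k).card = chainCount ε n k := by
  induction n generalizing k with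
  | zero =>
    rw [chainCount, Finset.card_eq_one]
    refine ⟨fun _ => k, ?_⟩
    ext f
    simp only [IsSignedChain, Finset.mem_singleton, funext_iff]
    simp [Subsingleton.elim _ (0 : Fin 1)]
  | succ n ih =>
    rw [chainCount, ← sum_chainStep (ε n) k]
    simp only [← ih]
    -- Chains are sorted by their next-to-last letter `j`; deleting the last letter is a bijection
    -- if `j` may precede `k`, and otherwise the fibre is empty.
    rw [Finset.card_eq_sum_card_fiberwise (f := fun f => f (Fin.last n).castSucc)
      (t := Finset.univ) fun _ _ => Finset.mem_coe.mpr (Finset.mem_univ _)]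
    refine Finset.sum_congr rfl fun j _ => ?_
    have hs (f : Fin (n + 2) → Fin M) := isSignedChain_snoc (ε := ε) (Fin.init f) (f (Fin.last _))
    simp only [Fin.snoc_init_self] at hs
    split_ifs with hst
    · refine Finset.card_nbij' (fun f => Fin.init f) (fun f => Fin.snoc f k) ?_ ?_ ?_ ?_
      · intro f hf
        simp only [Finset.coe_filter, Finset.mem_filter, Finset.mem_univ, true_and,
          Set.mem_ofPred_eq] at hf ⊢
        exact ⟨((hs f).mp hf.1.1).1, hf.2⟩
      · intro f hf
        simp only [Finset.coe_filter, Finset.mem_filter, Finset.mem_univ, true_and,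
          Set.mem_ofPred_eq] at hf ⊢
        refine ⟨⟨(isSignedChain_snoc f k).mpr ⟨hf.1, ?_⟩, Fin.snoc_last _ _⟩, ?_⟩
        · rwa [hf.2]
        · rw [Fin.snoc_castSucc, hf.2]
      · intro f hf
        simp only [Finset.coe_filter, Finset.mem_filter, Finset.mem_univ, true_and,
          Set.mem_ofPred_eq] at hf
        rw [← hf.1.2]
        exact Fin.snoc_init_self f
      · intro f _
        exact Fin.init_snoc _ _
    · rw [Finset.card_eq_zero, Finset.filter_eq_empty_iff]
      intro f hf hj
      simp only [Finset.mem_filter, Finset.mem_univ, true_and] at hf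
      apply hst
      have := ((hs f).mp hf.1).2
      rwa [hf.2, Fin.init, hj] at this

/-- The ascent pattern of a permutation. -/
def ascentAt {n : ℕ} (w : Equiv.Perm (Fin n)) (i : ℕ) : Prop :=
  ∃ h : i + 1 < n, w ⟨i, by omega⟩ < w ⟨i + 1, h⟩

/-- Along `π⁻¹` the keys must increase. For equal consecutive letters this compares positions: an
ascent of `π⁻¹` is needed if the letter is odd, a descent if it is even. -/
theorem wordPerm_eq_iff {n : ℕ} (v : Fin (n + 1) → ℕ) (π : Equiv.Perm (Fin (n + 1))) :
    wordPerm v = π ↔ IsSignedChain (ascentAt π⁻¹) fun i => v (π⁻¹ i) := by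
  rw [wordPerm, stdPerm_eq_iff, Fin.strictMono_iff_lt_succ]
  refine forall_congr' fun i => ?_
  have h : ascentAt π⁻¹ i ↔ π⁻¹ i.castSucc < π⁻¹ i.succ :=
    ⟨fun h => h.2, fun h => ⟨by omega, h⟩⟩
  have hne : π⁻¹ i.castSucc ≠ π⁻¹ i.succ := π⁻¹.injective.ne (Fin.castSucc_lt_succ).ne
  rw [signedKey_lt_iff, ChainStep, h]
  refine or_congr_right (and_congr_right fun he => ?_)
  rw [he]
  split_ifs with ho
  · simp only [ho, true_iff]
  · simp only [ho, false_iff, not_lt]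
    exact ⟨le_of_lt, fun h => lt_of_le_of_ne h hne.symm⟩

theorem wordCount_eq (M : ℕ) {n : ℕ} (π : Equiv.Perm (Fin (n + 1))) :
    wordCount M π = ∑ k ∈ Finset.range M, chainCount (ascentAt π⁻¹) n k := by
  classical
  rw [wordCount, ← Fin.sum_univ_eq_sum_range]
  simp only [← card_chains]
  rw [Finset.card_eq_sum_card_fiberwise (f := fun v => v (π⁻¹ (Fin.last n)))
      (t := Finset.univ) fun _ _ => Finset.mem_coe.mpr (Finset.mem_univ _)]
  refine Finset.sum_congr rfl fun k _ => ?_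
  rw [Finset.filter_filter]
  refine Finset.card_equiv (Equiv.arrowCongr π (Equiv.refl _)) fun v => ?_
  simp only [Finset.mem_filter, Finset.mem_univ, true_and, wordPerm_eq_iff]
  rfl

/-! ### The generating function of chains -/

open scoped Classical in
/-- The number of `i < n` preceded by an ascent and followed by a descent. -/
noncomputable def peakCount (ε : ℕ → Prop) (n : ℕ) : ℕ :=
  ((Finset.range n).filter fun i => 0 < i ∧ ε (i - 1) ∧ ¬ ε i).card

open scoped Classical in
theorem peakCount_succ (ε : ℕ → Prop) (n : ℕ) :
    peakCount ε (n + 1) = peakCount ε n + if 0 < n ∧ ε (n - 1) ∧ ¬ ε n then 1 else 0 := by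
  rw [peakCount, peakCount, Finset.range_add_one, Finset.filter_insert]
  split_ifs with h
  · rw [Finset.card_insert_of_notMem (by simp)]
  · rfl

theorem pk_eq_peakCount {n : ℕ} (w : Equiv.Perm (Fin (n + 1))) :
    pk w = peakCount (ascentAt w) n := by
  classical
  have hiff : ∀ i (h0 : 0 < i) (h : i < n), ((ascentAt w (i - 1) ∧ ¬ ascentAt w i) ↔
      w ⟨i - 1, by omega⟩ < w ⟨i, by omega⟩ ∧ w ⟨i + 1, by omega⟩ < w ⟨i, by omega⟩) := by
    intro i h0 h
    have hne : w ⟨i, by omega⟩ ≠ w ⟨i + 1, by omega⟩ := w.injective.ne (by simp)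
    have h1 : ascentAt w (i - 1) ↔ w ⟨i - 1, by omega⟩ < w ⟨i, by omega⟩ := by
      obtain ⟨j, rfl⟩ : ∃ j, i = j + 1 := ⟨i - 1, by omega⟩
      exact ⟨fun h => h.2, fun h' => ⟨by omega, h'⟩⟩
    have h2 : ascentAt w i ↔ w ⟨i, by omega⟩ < w ⟨i + 1, by omega⟩ :=
      ⟨fun h => h.2, fun h' => ⟨by omega, h'⟩⟩
    refine and_congr h1 ((not_congr h2).trans ?_)
    rw [not_lt]
    exact ⟨fun h => lt_of_le_of_ne h hne.symm, le_of_lt⟩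
  rw [pk, peakCount, ← Finset.card_map Fin.valEmbedding]
  congr 1
  ext i
  simp only [Finset.mem_map, Finset.mem_filter, Finset.mem_univ, true_and, Fin.valEmbedding_apply,
    Finset.mem_range]
  constructor
  · rintro ⟨i, ⟨h0, h, hw⟩, rfl⟩
    exact ⟨by omega, h0, (hiff i h0 (by omega)).mpr hw⟩
  · rintro ⟨h, h0, hw⟩
    exact ⟨⟨i, by omega⟩, ⟨h0, by simpa using h, (hiff i h0 h).mp hw⟩, rfl⟩

section

open PowerSeries

variable (B : Type*) [CommRing B] (ε : ℕ → Prop) (n : ℕ)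

/-- Generating function of the chains that end in an even letter. -/
noncomputable def evenSeries : B⟦X⟧ := .mk fun m => (chainCount ε n (2 * m) : B)

/-- Generating function of the chains that end in an odd letter. -/
noncomputable def oddSeries : B⟦X⟧ := .mk fun m => (chainCount ε n (2 * m + 1) : B)

/-- Generating function of the chains in the letters `0, …, 2 m - 1`. -/
noncomputable def chainSeries : B⟦X⟧ :=
  .mk fun m => ((∑ k ∈ Finset.range (2 * m), chainCount ε n k : ℕ) : B)

/-- Multiplication by `1 - X` takes differences in `m`, and raising `m` by one adds one even and one
odd letter. -/
theorem one_sub_X_mul_chainSeries :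
    (1 - X) * chainSeries B ε n = X * (evenSeries B ε n + oddSeries B ε n) := by
  ext m
  rw [sub_mul, one_mul, map_sub]
  cases m with
  | zero => simp [chainSeries]
  | succ m =>
    rw [coeff_succ_X_mul, coeff_succ_X_mul]
    simp only [chainSeries, evenSeries, oddSeries, map_add, coeff_mk]
    rw [show 2 * (m + 1) = 2 * m + 1 + 1 by ring, Finset.sum_range_succ, Finset.sum_range_succ]
    push_cast
    ring

open scoped Classical in
theorem evenSeries_succ :
    evenSeries B ε (n + 1) = chainSeries B ε n + if ε n then 0 else evenSeries B ε n := by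
  ext m
  have : ¬ Odd (2 * m) := by simp
  split_ifs with h <;> simp [evenSeries, chainSeries, chainCount, h]

open scoped Classical in
theorem oddSeries_succ :
    oddSeries B ε (n + 1) = chainSeries B ε n + evenSeries B ε n +
      if ε n then oddSeries B ε n else 0 := by
  ext m
  have : Odd (2 * m + 1) := by simp
  split_ifs with h <;>
    simp [evenSeries, oddSeries, chainSeries, chainCount, h, Finset.sum_range_succ]

variable {B}

theorem isUnit_one_sub_X : IsUnit (1 - X : B⟦X⟧) := by
  rw [isUnit_iff_constantCoeff]
  simp

-- Write `E`, `O`, `S` for the even, odd and total series, so that `(1 - X) S = X (E + O)`. An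
-- ascent gives `S` and `S + E + O`, of ratio `X`; a descent gives `S + E` twice, of ratio `1`. The
-- ratio must be carried along because the effect of a descent depends on it: `E + O` is multiplied
-- by `r` if `E = O`, but by `r u` if `E = X O`, that is, at a peak. An ascent always multiplies it
-- by `r`.
open scoped Classical in
theorem chain_recursion {r u : B⟦X⟧} (hr : r * (1 - X) = 1 + X) (hu : u * (1 + X) ^ 2 = 4 * X) :
    (evenSeries B ε n = (if 0 < n ∧ ε (n - 1) then X else 1) * oddSeries B ε n) ∧
    (1 - X) * (evenSeries B ε n + oddSeries B ε n) = 2 * r ^ n * u ^ peakCount ε n := by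
  classical
  have hc {a b : B⟦X⟧} (h : (1 - X) * a = (1 - X) * b) : a = b :=
    isUnit_one_sub_X.mul_left_cancel h
  induction n with
  | zero =>
    have h : (1 - X : B⟦X⟧) * .mk (fun _ => 1) = 1 := by
      rw [mul_comm]
      exact PowerSeries.mk_one_mul_one_sub_eq_one B
    simp [evenSeries, oddSeries, chainCount, peakCount, mul_add, h]
    norm_num
  | succ n ih =>
    obtain ⟨h1, h2⟩ := ih
    have hS := one_sub_X_mul_chainSeries B ε n
    rw [evenSeries_succ, oddSeries_succ, peakCount_succ]
    simp only [Nat.succ_pos, true_and, Nat.add_sub_cancel]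
    generalize chainSeries B ε n = S at *
    generalize evenSeries B ε n = E at *
    generalize oddSeries B ε n = O at *
    by_cases hn : ε n
    · simp only [hn, if_true, not_true, and_false, if_false, add_zero]
      constructor
      · apply hc
        linear_combination (1 - X) * hS
      · apply hc
        rw [pow_succ]
        linear_combination 2 * (1 - X) * hS + (1 + X) * h2 - 2 * r ^ n * u ^ peakCount ε n * hr
    · simp only [hn, if_false, not_false_iff, and_true, add_zero, one_mul]
      refine ⟨trivial, ?_⟩
      apply hc
      split_ifs at h1 ⊢
      · rw [pow_succ, pow_succ]
        linear_combination 2 * (1 - X) * hS + 2 * (1 - X) * h1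
          - 2 * r ^ n * u ^ peakCount ε n * u * hr + u * (1 + X) * h2 - (1 - X) * O * hu
          - u * (1 + X) * (1 - X) * h1
      · rw [pow_succ, add_zero]
        linear_combination 2 * (1 - X) * hS + (1 - X) ^ 2 * h1 + (1 + X) * h2
          - 2 * r ^ n * u ^ peakCount ε n * hr

theorem chainSeries_eq {r u : B⟦X⟧} (hr : r * (1 - X) = 1 + X)
    (hu : u * (1 + X) ^ 2 = 4 * X) :
    (1 - X) ^ 2 * chainSeries B ε n = 2 * X * r ^ n * u ^ peakCount ε n := by
  linear_combination (1 - X) * one_sub_X_mul_chainSeries B ε n + X * (chain_recursion ε n hr hu).2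

end

/-! ### Extraction of the coefficients of powers of `t` -/

open Polynomial in
/-- The embedding of the coefficient ring. -/
noncomputable def coeffEmb : ℚ[X] →+* Series := PowerSeries.C.comp PowerSeries.C

/-- The series `(1+t)/(1-t)`. -/
noncomputable def rSeries : Series := quot (1 + tVar) (1 - tVar)

/-- The series `(1+t)/(2(1-t))`. -/
noncomputable def halfSeries : Series := quot (1 + tVar) (2 * (1 - tVar))

theorem isUnit_two_mul_one_sub_tVar : IsUnit (2 * (1 - tVar)) :=
  isUnit_two.mul isUnit_one_sub_tVar

theorem rSeries_mul : rSeries * (1 - tVar) = 1 + tVar := quot_mul_cancel _ isUnit_one_sub_tVar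

theorem halfSeries_mul : halfSeries * (2 * (1 - tVar)) = 1 + tVar :=
  quot_mul_cancel _ isUnit_two_mul_one_sub_tVar

theorem uSeries_mul : uSeries * (1 + tVar) ^ 2 = 4 * tVar :=
  quot_mul_cancel _ (isUnit_one_add_tVar.pow 2)

theorem zSeries_eq : zSeries = rSeries * xVar := by
  apply isUnit_one_sub_tVar.mul_right_cancel
  rw [zSeries, quot_mul_cancel _ isUnit_one_sub_tVar]
  linear_combination -xVar * rSeries_mul

theorem isUnit_halfSeries : IsUnit halfSeries := by
  apply isUnit_of_mul_isUnit_left (y := 2 * (1 - tVar))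
  rw [halfSeries_mul]
  exact isUnit_one_add_tVar

/-- The prefactor and the additional factors `u` and `r` combine to `2t/(1-t)²`, which is the factor
in `chainSeries_eq`. -/
theorem halfSeries_mul_eq_chainSeries {n : ℕ} (π : Equiv.Perm (Fin (n + 1))) :
    halfSeries * uSeries ^ (ipk π + 1) * rSeries ^ (n + 1) =
      chainSeries (PowerSeries (Polynomial ℚ)) (ascentAt π⁻¹) n := by
  have h := chainSeries_eq (ascentAt π⁻¹) n rSeries_mul uSeries_mul
  rw [ipk, pk_eq_peakCount]
  apply (isUnit_two.mul (isUnit_one_sub_tVar.pow 2)).mul_left_cancel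
  rw [show (PowerSeries.X : Series) = tVar from rfl] at h
  generalize chainSeries (PowerSeries (Polynomial ℚ)) (ascentAt π⁻¹) n = S at *
  generalize peakCount (ascentAt π⁻¹) n = p at *
  rw [pow_succ, pow_succ]
  linear_combination (rSeries * uSeries ^ (p + 1) * rSeries ^ n * (1 - tVar)) * halfSeries_mul
    + (1 + tVar) * uSeries ^ (p + 1) * rSeries ^ n * rSeries_mul
    + uSeries ^ p * rSeries ^ n * uSeries_mul - 2 * h

theorem coeff_halfSeries_mul {n : ℕ} (c : Equiv.Perm (Fin (n + 1)) → Polynomial ℚ) (m : ℕ) :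
    PowerSeries.coeff m (halfSeries *
        ((∑ π, coeffEmb (c π) * uSeries ^ (ipk π + 1)) * zSeries ^ (n + 1))) =
      PowerSeries.C (∑ π, wordCount (2 * m) π * c π) * PowerSeries.X ^ (n + 1) := by
  have h : halfSeries * ((∑ π, coeffEmb (c π) * uSeries ^ (ipk π + 1)) * zSeries ^ (n + 1)) =
      ∑ π : Equiv.Perm (Fin (n + 1)), PowerSeries.C (PowerSeries.C (c π) * PowerSeries.X ^ (n + 1)) *
        chainSeries (PowerSeries (Polynomial ℚ)) (ascentAt π⁻¹) n := by
    rw [Finset.sum_mul, Finset.mul_sum]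
    refine Finset.sum_congr rfl fun π _ => ?_
    rw [← halfSeries_mul_eq_chainSeries, zSeries_eq, map_mul, map_pow,
      show PowerSeries.C PowerSeries.X = xVar from rfl,
      show PowerSeries.C (PowerSeries.C (c π)) = coeffEmb (c π) from rfl]
    ring
  rw [h, map_sum, map_sum, Finset.sum_mul]
  refine Finset.sum_congr rfl fun π _ => ?_
  rw [PowerSeries.coeff_C_mul, chainSeries, PowerSeries.coeff_mk, ← wordCount_eq, map_mul,
    map_natCast]
  ring

theorem Pipk_eq (Γ : Set AllPerm) (n : ℕ) : Pipk Γ (n + 1) sVar uSeries =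
    ∑ π : Equiv.Perm (Fin (n + 1)),
      coeffEmb (Polynomial.X ^ occ Γ π) * uSeries ^ (ipk π + 1) := by
  rw [Pipk, if_neg (Nat.succ_ne_zero n)]
  simp only [map_pow]
  rfl

theorem Ripk_eq (Γ : Set AllPerm) (n : ℕ) : Ripk Γ n (sVar - 1) uSeries =
    ∑ π : Equiv.Perm (Fin n),
      coeffEmb (clusterSum Γ (Polynomial.X - 1) π) * uSeries ^ (ipk π + 1) := by
  rw [Ripk]
  refine Finset.sum_congr rfl fun π _ => ?_
  rw [clusterSum, map_sum, mul_comm]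
  simp only [map_pow, map_sub, map_one]
  rfl

theorem coeff_halfSeries_mul_Pipk (Γ : Set AllPerm) (n m : ℕ) :
    PowerSeries.coeff m (halfSeries * (Pipk Γ (n + 1) sVar uSeries * zSeries ^ (n + 1))) =
      PowerSeries.C (wordOccSum Γ Polynomial.X (2 * m) (n + 1)) * PowerSeries.X ^ (n + 1) := by
  rw [Pipk_eq, coeff_halfSeries_mul]
  rfl

theorem coeff_halfSeries_mul_Ripk (Γ : Set AllPerm) (n m : ℕ) :
    PowerSeries.coeff m (halfSeries * (Ripk Γ (n + 1) (sVar - 1) uSeries * zSeries ^ (n + 1))) =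
      PowerSeries.C (wordClusterSum Γ (Polynomial.X - 1) (2 * m) (n + 1)) *
        PowerSeries.X ^ (n + 1) := by
  rw [Ripk_eq, coeff_halfSeries_mul]
  rfl

theorem Ripk_one {Γ : Set AllPerm} (hΓ : ∀ σ ∈ Γ, 2 ≤ σ.1) :
    Ripk Γ 1 (sVar - 1) uSeries = uSeries := by
  have hocc (π : Equiv.Perm (Fin 1)) : occurrences Γ π = ∅ := by
    rw [Finset.eq_empty_iff_forall_notMem]
    intro p hp
    have h1 := hΓ _ ((mem_occurrences _ _ _).mp hp).1
    have h2 := add_length_le_of_mem_occurrences hp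
    omega
  have hcl (π : Equiv.Perm (Fin 1)) : clusters Γ π = {∅} := by
    ext T
    rw [mem_clusters_iff, hocc, Finset.subset_empty, Finset.mem_singleton]
    exact and_iff_left fun a h h' => by omega
  have hpk (π : Equiv.Perm (Fin 1)) : ipk π = 0 := by
    rw [ipk, pk_eq_peakCount]
    simp [peakCount]
  simp [Ripk, hcl, hpk]

/-- The separate term `2tx/(1-t)²` is the missing summand `k = 1` of the cluster sum: a single
letter carries no mark when all patterns have length at least `2`. -/
theorem coeff_linear_term {Γ : Set AllPerm} (hΓ : ∀ σ ∈ Γ, 2 ≤ σ.1) (m : ℕ) :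
    PowerSeries.coeff m (quot (2 * tVar * xVar) ((1 - tVar) ^ 2)) =
      PowerSeries.C (wordClusterSum Γ (Polynomial.X - 1) (2 * m) 1) * PowerSeries.X ^ 1 := by
  rw [← coeff_halfSeries_mul_Ripk, Ripk_one hΓ, zSeries_eq]
  refine congrArg _ ?_
  apply (isUnit_two.mul (isUnit_one_sub_tVar.pow 2)).mul_left_cancel
  linear_combination 2 * quot_mul_cancel (2 * tVar * xVar) (isUnit_one_sub_tVar.pow 2)
    - uSeries * rSeries * xVar * (1 - tVar) * halfSeries_mul
    - (1 + tVar) * uSeries * xVar * rSeries_mul - xVar * uSeries_mul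

theorem coeff_quot_one (m : ℕ) : PowerSeries.coeff m (quot 1 (1 - tVar)) = 1 := by
  have h : quot 1 (1 - tVar) = .mk fun _ => 1 := by
    apply isUnit_one_sub_tVar.mul_right_cancel
    rw [quot_mul_cancel _ isUnit_one_sub_tVar]
    exact (PowerSeries.mk_one_mul_one_sub_eq_one _).symm
  rw [h, PowerSeries.coeff_mk]

theorem coeff_hadamardPow (f : Series) (n m : ℕ) :
    PowerSeries.coeff m (hadamardPow f n) = PowerSeries.coeff m f ^ n := by
  induction n with
  | zero => simp [hadamardPow]
  | succ n ih => rw [hadamardPow, hadamard, PowerSeries.coeff_mk, ih, pow_succ]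

/-! ### Convergence -/

/-- The `n`-th term lives in `x`-degree `n + N` alone, so at most one term contributes to each
coefficient. -/
theorem hasSum_of_coeff {g : ℕ → Series} {c : ℕ → ℕ → Polynomial ℚ} (N : ℕ)
    (h : ∀ n m, PowerSeries.coeff m (g n) =
      PowerSeries.C (c m (n + N)) * PowerSeries.X ^ (n + N)) :
    HasSum g (.mk fun m => .mk fun j => if N ≤ j then c m j else 0) := by
  rw [PowerSeries.WithPiTopology.hasSum_iff_hasSum_coeff]
  intro m
  rw [PowerSeries.WithPiTopology.hasSum_iff_hasSum_coeff]
  intro j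
  simp only [h, PowerSeries.coeff_C_mul, PowerSeries.coeff_X_pow, PowerSeries.coeff_mk]
  -- For `j < N` the truncated difference is `0`, and the term there vanishes as well.
  convert hasSum_single (f := fun n => c m (n + N) * if j = n + N then 1 else 0) (j - N) ?_ using 1
  · split_ifs with h1 h2 h2
    · rw [mul_one, h2.symm]
    · omega
    · omega
    · simp
  · intro n hn
    rw [if_neg (by omega), mul_zero]

/-- The generating function by length of words in `M` letters, occurrences being weighted. -/
noncomputable def wordOccSeries (Γ : Set AllPerm) (M : ℕ) : PowerSeries (Polynomial ℚ) :=
  .mk fun n => wordOccSum Γ Polynomial.X M n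

/-- The generating function by length of clusters on nonempty words in `M` letters. -/
noncomputable def wordClusterSeries (Γ : Set AllPerm) (M : ℕ) : PowerSeries (Polynomial ℚ) :=
  .mk fun n => if n = 0 then 0 else wordClusterSum Γ (Polynomial.X - 1) M n

theorem wordOccSum_zero {Γ : Set AllPerm} (hΓ : ∀ σ ∈ Γ, 2 ≤ σ.1) (M : ℕ) :
    wordOccSum Γ (Polynomial.X : Polynomial ℚ) M 0 = 1 := by
  have hocc (π : Equiv.Perm (Fin 0)) : occ Γ π = 0 := by
    rw [occ, Finset.card_eq_zero, Finset.eq_empty_iff_forall_notMem]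
    intro p hp
    have h1 := hΓ _ ((mem_occurrences _ _ _).mp hp).1
    have h2 := add_length_le_of_mem_occurrences hp
    omega
  rw [wordOccSum, ← sum_wordPerm M 0 fun π => (Polynomial.X : Polynomial ℚ) ^ occ Γ π]
  simp [hocc]

/-- This is the convolution `wordOccSum_eq` in generating-function form; the constant term `1` is
the empty word, which has no leading cluster. -/
theorem wordOccSeries_mul {Γ : Set AllPerm} (hΓ : ∀ σ ∈ Γ, 2 ≤ σ.1) (M : ℕ) :
    (1 - wordClusterSeries Γ M) * wordOccSeries Γ M = 1 := by
  rw [sub_mul, one_mul, sub_eq_iff_eq_add]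
  ext1 n
  rw [map_add, PowerSeries.coeff_mul, PowerSeries.coeff_one]
  cases n with
  | zero => simp [wordOccSeries, wordClusterSeries, wordOccSum_zero hΓ]
  | succ n =>
    rw [Finset.Nat.sum_antidiagonal_eq_sum_range_succ_mk, Finset.sum_range_succ',
      ← Fin.sum_univ_eq_sum_range (fun k => PowerSeries.coeff (k + 1) (wordClusterSeries Γ M) *
        PowerSeries.coeff (n + 1 - (k + 1)) (wordOccSeries Γ M))]
    simp only [wordOccSeries, wordClusterSeries, PowerSeries.coeff_mk, Nat.succ_ne_zero, if_false,
      if_true, zero_mul, add_zero, zero_add]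
    exact wordOccSum_eq hΓ _ M n.succ_pos

theorem hasSum_wordClusterSeries_pow {Γ : Set AllPerm} (hΓ : ∀ σ ∈ Γ, 2 ≤ σ.1) (M : ℕ) :
    HasSum (fun n => wordClusterSeries Γ M ^ n) (wordOccSeries Γ M) := by
  have h0 : PowerSeries.constantCoeff (wordClusterSeries Γ M) = 0 := by
    simp [wordClusterSeries, ← PowerSeries.coeff_zero_eq_constantCoeff_apply]
  have h := (PowerSeries.WithPiTopology.summable_pow_of_constantCoeff_eq_zero h0).hasSum
  rwa [left_inv_eq_right_inv
    (PowerSeries.WithPiTopology.tsum_pow_mul_one_sub_of_constantCoeff_eq_zero h0)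
    (wordOccSeries_mul hΓ M)] at h

end ClusterMethod

theorem theorem3p6 (Γ : Set AllPerm) (hΓ : ∀ σ ∈ Γ, 2 ≤ σ.1) :
    Summable (fun n : ℕ => Pipk Γ (n + 1) sVar uSeries * zSeries ^ (n + 1)) ∧
    Summable (fun k : ℕ => Ripk Γ (k + 2) (sVar - 1) uSeries * zSeries ^ (k + 2)) ∧
    HasSum
      (fun n : ℕ => hadamardPow
        (quot (2 * tVar * xVar) ((1 - tVar) ^ 2) +
          quot (1 + tVar) (2 * (1 - tVar)) *
            ∑' k : ℕ, Ripk Γ (k + 2) (sVar - 1) uSeries * zSeries ^ (k + 2)) n)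
      (quot 1 (1 - tVar) +
        quot (1 + tVar) (2 * (1 - tVar)) *
          ∑' n : ℕ, Pipk Γ (n + 1) sVar uSeries * zSeries ^ (n + 1)) := by
  have hP := hasSum_of_coeff (c := fun m => wordOccSum Γ Polynomial.X (2 * m)) 1
    fun n m => coeff_halfSeries_mul_Pipk Γ n m
  have hR := hasSum_of_coeff (c := fun m => wordClusterSum Γ (Polynomial.X - 1) (2 * m)) 2
    fun n m => coeff_halfSeries_mul_Ripk Γ (n + 1) m
  -- Coefficients are known only after multiplication by the prefactor. As it is a unit, summability
  -- of the original sums follows by multiplying back with its inverse.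
  obtain ⟨v, hv⟩ := isUnit_halfSeries
  rw [← hv] at hP hR
  have hP' : Summable fun n : ℕ => Pipk Γ (n + 1) sVar uSeries * zSeries ^ (n + 1) := by simpa using hP.summable.mul_left (↑v⁻¹ : Series)
  have hR' : Summable fun k : ℕ =>
      Ripk Γ (k + 2) (sVar - 1) uSeries * zSeries ^ (k + 2) := by simpa using hR.summable.mul_left (↑v⁻¹ : Series)
  refine ⟨hP', hR', ?_⟩
  have hPe := (hP'.hasSum.mul_left (v : Series)).unique hP
  have hRe := (hR'.hasSum.mul_left (v : Series)).unique hR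
  rw [show quot (1 + tVar) (2 * (1 - tVar)) = v from hv.symm, hPe, hRe,
    PowerSeries.WithPiTopology.hasSum_iff_hasSum_coeff]
  intro m
  simp only [coeff_hadamardPow, map_add, coeff_quot_one, coeff_linear_term hΓ,
    PowerSeries.coeff_mk]
  -- The linear term supplies degree `1` of the cluster series; below, the coefficient `1` of
  -- `1/(1-t)` supplies the empty word.
  have hF : PowerSeries.C (wordClusterSum Γ (Polynomial.X - 1) (2 * m) 1) * PowerSeries.X ^ 1 +
      (.mk fun j => if 2 ≤ j then wordClusterSum Γ (Polynomial.X - 1) (2 * m) j else 0) =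
      wordClusterSeries Γ (2 * m) := by
    ext1 j
    rw [map_add, PowerSeries.coeff_C_mul, PowerSeries.coeff_X_pow, wordClusterSeries]
    simp only [PowerSeries.coeff_mk]
    rcases j with _ | _ | j <;> simp
  have hL : 1 + (.mk fun j => if 1 ≤ j then wordOccSum Γ Polynomial.X (2 * m) j else 0) =
      wordOccSeries Γ (2 * m) := by
    ext1 j
    rw [map_add, PowerSeries.coeff_one, wordOccSeries]
    simp only [PowerSeries.coeff_mk]
    rcases j with _ | j <;> simp [wordOccSum_zero hΓ]
  rw [hF, hL]
  exact hasSum_wordClusterSeries_pow hΓ (2 * m)
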